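/- Let $\Omega\subset\mathbb{R}^2$ be a nonempty bounded open set (for instance, a bounded, connected Lipschitz domain). For every real constant $c\neq 0$, the problem of minimising $$\frac12\int_\Omega\bigl(|\nabla u(x)|^2+|\nabla v(x)|^2\bigr)\,dx$$ over all $(u,v)\in H^1(\Omega;\mathbb{R}^2)$ subject to the constraint $$\int_\Omega\det(\nabla u(x),\nabla v(x))\,dx=c$$ has a minimiser: there is a pair $(u_c,v_c)\in H^1(\Omega;\mathbb{R}^2)$ that satisfies the constraint and whose energy is at most that of every pair in $H^1(\Omega;\mathbb{R}^2)$ satisfying the constraint. Here $\nabla$ is the weak gradient and $\det(a,b)=a_1b_2-a_2b_1$ for $a,b\in\mathbb{R}^2$. -/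

import Mathlib

open MeasureTheory Set

open scoped ContDiff

noncomputable section

/-- The Euclidean plane `ℝ²`. -/
abbrev Plane : Type := EuclideanSpace ℝ (Fin 2)

/-- `G` is a weak gradient of `u` in `Ω`: for every test function `φ ∈ C_c^∞(Ω)` and each
coordinate `i`, `∫_Ω u ∂ᵢφ = - ∫_Ω Gᵢ φ`. -/
def IsWeakGradient (Ω : Set Plane) (u : Plane → ℝ) (G : Plane → Plane) : Prop :=
  ∀ φ : Plane → ℝ, ContDiff ℝ ∞ φ → HasCompactSupport φ → tsupport φ ⊆ Ω →
    ∀ i : Fin 2,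
      ∫ x in Ω, u x * fderiv ℝ φ x (EuclideanSpace.single i 1) = -∫ x in Ω, G x i * φ x

/-- `u ∈ H¹(Ω)`: `u` is in `L²(Ω)` and has a weak gradient in `L²(Ω; ℝ²)`. -/
def MemH1 (Ω : Set Plane) (u : Plane → ℝ) : Prop :=
  MemLp u 2 (volume.restrict Ω) ∧
    ∃ G : Plane → Plane, MemLp G 2 (volume.restrict Ω) ∧ IsWeakGradient Ω u G

open Classical in
/-- The weak gradient `∇u ∈ L²(Ω; ℝ²)` of `u ∈ H¹(Ω)`, which on an open set is unique up to
equality almost everywhere in `Ω`. It is only used for `u ∈ H¹(Ω)`; elsewhere it is set to `0`. -/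
def weakGrad (Ω : Set Plane) (u : Plane → ℝ) : Plane → Plane :=
  if h : MemH1 Ω u then h.2.choose else 0

/-- The determinant of the matrix with rows `a` and `b`. -/
def planeDet (a b : Plane) : ℝ := !![a 0, a 1; b 0, b 1].det

/-- The energy `½ ∫_Ω (|∇u|² + |∇v|²)` of a pair `(u, v)`. -/
def dirichletEnergy (Ω : Set Plane) (p : (Plane → ℝ) × (Plane → ℝ)) : ℝ :=
  (1 / 2) * ∫ x in Ω, (‖weakGrad Ω p.1 x‖ ^ 2 + ‖weakGrad Ω p.2 x‖ ^ 2)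

/-- The pairs `(u, v) ∈ H¹(Ω; ℝ²)` with `∫_Ω det(∇u, ∇v) = c`. -/
def admissiblePairs (Ω : Set Plane) (c : ℝ) : Set ((Plane → ℝ) × (Plane → ℝ)) :=
  {p | MemH1 Ω p.1 ∧ MemH1 Ω p.2 ∧
    ∫ x in Ω, planeDet (weakGrad Ω p.1 x) (weakGrad Ω p.2 x) = c}

end

/-! Pointwise, `|det(a, b)| ≤ ½ (|a|² + |b|²)`, with equality exactly when the matrix with rows `a`
and `b` is a multiple of an orthogonal one. Integrating, every pair has energy at least
`|∫_Ω det(∇u, ∇v)| = |c|`, and a pair of linear functions given by a multiple of the identity or of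
a reflection, with determinant `c / |Ω|`, attains this bound. Linear functions lie in `H¹(Ω)` as
soon as `Ω` has a finite second moment, which also makes `|Ω|` finite. -/

open InnerProductSpace

theorem integrable_smul_of_locallyIntegrableOn {X E : Type*} [TopologicalSpace X] [T2Space X]
    [MeasurableSpace X] [OpensMeasurableSpace X] {μ : Measure X} [NormedAddCommGroup E]
    [NormedSpace ℝ E] {s : Set X} {f : X → E} {φ : X → ℝ} (hf : LocallyIntegrableOn f s μ)
    (hφ : Continuous φ) (hc : HasCompactSupport φ) (hs : tsupport φ ⊆ s) :
    Integrable (fun x => φ x • f x) μ := by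
  have hsupp : Function.support (fun x => φ x • f x) ⊆ tsupport φ :=
    (Function.support_smul_subset_left φ f).trans (subset_tsupport φ)
  have hK : IntegrableOn f (tsupport φ) μ := (hf.mono_set hs).integrableOn_isCompact hc
  exact (integrableOn_iff_integrable_of_support_subset hsupp).1
    (hK.continuousOn_smul hφ.continuousOn hc)

theorem integrable_mul_of_locallyIntegrableOn {X : Type*} [TopologicalSpace X] [T2Space X]
    [MeasurableSpace X] [OpensMeasurableSpace X] {μ : Measure X} {s : Set X} {f φ : X → ℝ}
    (hf : LocallyIntegrableOn f s μ) (hφ : Continuous φ) (hc : HasCompactSupport φ)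
    (hs : tsupport φ ⊆ s) : Integrable (fun x => f x * φ x) μ := by
  simpa only [smul_eq_mul, mul_comm] using integrable_smul_of_locallyIntegrableOn hf hφ hc hs

section SecondMoment

variable {E : Type*} [NormedAddCommGroup E] [ProperSpace E] [MeasurableSpace E] {μ : Measure E}
  [IsFiniteMeasureOnCompacts μ] {p : ENNReal}

theorem isFiniteMeasure_of_memLp_id (hp : p ≠ 0) (hp' : p ≠ ⊤) (h : MemLp id p μ) :
    IsFiniteMeasure μ := by
  have hball : μ (Metric.closedBall 0 1) < ⊤ := (isCompact_closedBall 0 1).measure_lt_top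
  have htail : μ {x | 1 ≤ ‖x‖₊} < ⊤ := h.meas_ge_lt_top hp hp' one_ne_zero
  have hcover : Metric.closedBall (0 : E) 1 ∪ {x | 1 ≤ ‖x‖₊} = univ :=
    eq_univ_of_forall fun x => (le_total ‖x‖ 1).imp mem_closedBall_zero_iff.2 id
  exact ⟨hcover ▸ measure_union_lt_top hball htail⟩

theorem memLp_id_restrict_of_isBounded [BorelSpace E] {s : Set E} (hs : Bornology.IsBounded s) :
    MemLp id p (μ.restrict s) := by
  obtain ⟨R, hR⟩ := hs.subset_closedBall 0
  have : IsFiniteMeasure (μ.restrict (Metric.closedBall 0 R)) :=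
    isFiniteMeasure_restrict.2 (isCompact_closedBall 0 R).measure_ne_top
  have hball : MemLp id p (μ.restrict (Metric.closedBall 0 R)) :=
    MemLp.of_bound aestronglyMeasurable_id R <|
      ae_restrict_of_forall_mem measurableSet_closedBall fun _ => mem_closedBall_zero_iff.1
  exact hball.mono_measure (Measure.restrict_mono hR le_rfl)

end SecondMoment

section Gradient

variable {F : Type*} [NormedAddCommGroup F] [InnerProductSpace ℝ F] [CompleteSpace F]

theorem gradient_inner_left (a x : F) : gradient (inner ℝ a) x = a :=
  HasGradientAt.gradient (toDual ℝ F a).hasFDerivAt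

theorem continuousOn_gradient_of_isOpen {s : Set F} {f : F → ℝ} (hs : IsOpen s)
    (hf : ContDiffOn ℝ 1 f s) : ContinuousOn (gradient f) s :=
  (toDual ℝ F).symm.continuous.comp_continuousOn (hf.continuousOn_fderiv_of_isOpen hs le_rfl)

theorem gradient_apply_eq_fderiv_single {ι : Type*} [Fintype ι] [DecidableEq ι]
    (f : EuclideanSpace ℝ ι → ℝ) (x : EuclideanSpace ℝ ι) (i : ι) :
    gradient f x i = fderiv ℝ f x (EuclideanSpace.single i 1) := by
  rw [← inner_gradient_left, EuclideanSpace.inner_single_right, one_mul, conj_trivial]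

end Gradient

section WeakGradient

variable {Ω : Set Plane} {u : Plane → ℝ} {G H : Plane → Plane}

theorem IsWeakGradient.ae_eq (hΩ : IsOpen Ω) (hG : IsWeakGradient Ω u G)
    (hH : IsWeakGradient Ω u H) (hGi : LocallyIntegrableOn G Ω) (hHi : LocallyIntegrableOn H Ω) :
    G =ᵐ[volume.restrict Ω] H := by
  have hzero : ∀ᵐ x, x ∈ Ω → G x - H x = 0 := by
    refine hΩ.ae_eq_zero_of_integral_contDiff_smul_eq_zero (hGi.sub hHi) fun φ hφ hc hs => ?_
    have hφG := integrable_smul_of_locallyIntegrableOn hGi hφ.continuous hc hs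
    have hφH := integrable_smul_of_locallyIntegrableOn hHi hφ.continuous hc hs
    have hφ0 : ∀ x, x ∉ Ω → φ x = 0 := fun x hx =>
      image_eq_zero_of_notMem_tsupport fun h => hx (hs h)
    have htest : ∫ x in Ω, φ x • G x = ∫ x in Ω, φ x • H x := by
      ext i
      rw [eval_integral_piLp fun j => hφG.integrableOn.eval_piLp j,
        eval_integral_piLp fun j => hφH.integrableOn.eval_piLp j]
      simpa only [PiLp.smul_apply, smul_eq_mul, mul_comm, neg_inj] using
        (hG φ hφ hc hs i).symm.trans (hH φ hφ hc hs i)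
    rw [← setIntegral_eq_integral_of_forall_compl_eq_zero fun x hx => by rw [hφ0 x hx, zero_smul]]
    simp only [smul_sub]
    rw [integral_sub hφG.integrableOn hφH.integrableOn, htest, sub_self]
  exact (ae_restrict_iff' hΩ.measurableSet).2 (hzero.mono fun x hx hxΩ => sub_eq_zero.1 (hx hxΩ))

theorem isWeakGradient_gradient (hΩ : IsOpen Ω) (hu : ContDiffOn ℝ 1 u Ω) :
    IsWeakGradient Ω u (gradient u) := by
  intro φ hφ hc hs i
  set e : Plane := EuclideanSpace.single i 1
  have hφ' : Continuous fun x => fderiv ℝ φ x e :=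
    (hφ.continuous_fderiv (by simp)).clm_apply continuous_const
  have hs' : tsupport (fun x => fderiv ℝ φ x e) ⊆ Ω := (tsupport_fderiv_apply_subset ℝ e).trans hs
  have huloc : LocallyIntegrableOn u Ω := hu.continuousOn.locallyIntegrableOn hΩ.measurableSet
  have hu'loc : LocallyIntegrableOn (fun x => fderiv ℝ u x e) Ω :=
    ((hu.continuousOn_fderiv_of_isOpen hΩ le_rfl).clm_apply
      continuousOn_const).locallyIntegrableOn hΩ.measurableSet
  have hφ0 : ∀ x, x ∉ Ω → φ x = 0 := fun x hx =>
    image_eq_zero_of_notMem_tsupport fun h => hx (hs h)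
  have hφ'0 : ∀ x, x ∉ Ω → fderiv ℝ φ x e = 0 := fun x hx =>
    image_eq_zero_of_notMem_tsupport (f := fun x => fderiv ℝ φ x e) fun h => hx (hs' h)
  simp only [gradient_apply_eq_fderiv_single]
  rw [setIntegral_eq_integral_of_forall_compl_eq_zero fun x hx => by rw [hφ'0 x hx, mul_zero],
    setIntegral_eq_integral_of_forall_compl_eq_zero fun x hx => by rw [hφ0 x hx, mul_zero]]
  exact integral_mul_fderiv_eq_neg_fderiv_mul_of_integrable
    (integrable_mul_of_locallyIntegrableOn hu'loc hφ.continuous hc hs)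
    (integrable_mul_of_locallyIntegrableOn huloc hφ' (hc.fderiv_apply ℝ e) hs')
    (integrable_mul_of_locallyIntegrableOn huloc hφ.continuous hc hs)
    (fun x hx => (hu.contDiffAt (hΩ.mem_nhds (hs hx))).differentiableAt one_ne_zero)
    fun x _ => hφ.differentiable (by simp) x

theorem MemH1.memLp_weakGrad (h : MemH1 Ω u) : MemLp (weakGrad Ω u) 2 (volume.restrict Ω) := by
  rw [weakGrad, dif_pos h]
  exact h.2.choose_spec.1

theorem MemH1.isWeakGradient_weakGrad (h : MemH1 Ω u) : IsWeakGradient Ω u (weakGrad Ω u) := by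
  rw [weakGrad, dif_pos h]
  exact h.2.choose_spec.2

theorem MemH1.weakGrad_ae_eq_gradient (h : MemH1 Ω u) (hΩ : IsOpen Ω)
    (hu : ContDiffOn ℝ 1 u Ω) : weakGrad Ω u =ᵐ[volume.restrict Ω] gradient u :=
  h.isWeakGradient_weakGrad.ae_eq hΩ (isWeakGradient_gradient hΩ hu)
    (locallyIntegrableOn_of_locallyIntegrable_restrict
      (h.memLp_weakGrad.locallyIntegrable one_le_two))
    ((continuousOn_gradient_of_isOpen hΩ hu).locallyIntegrableOn hΩ.measurableSet)

end WeakGradient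

section Calibration

variable {Ω : Set Plane} {u v : Plane → ℝ}

theorem planeDet_eq (a b : Plane) : planeDet a b = a 0 * b 1 - a 1 * b 0 :=
  Matrix.det_fin_two_of _ _ _ _

theorem abs_planeDet_le (a b : Plane) : |planeDet a b| ≤ (1 / 2) * (‖a‖ ^ 2 + ‖b‖ ^ 2) := by
  rw [planeDet_eq, EuclideanSpace.real_norm_sq_eq, EuclideanSpace.real_norm_sq_eq,
    Fin.sum_univ_two, Fin.sum_univ_two, abs_le]
  constructor
  · linarith [sq_nonneg (a 0 + b 1), sq_nonneg (a 1 - b 0)]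
  · linarith [sq_nonneg (a 0 - b 1), sq_nonneg (a 1 + b 0)]

theorem exists_planeDet_eq_and_half_norm_sq_add_eq_abs (t : ℝ) :
    ∃ a b : Plane, planeDet a b = t ∧ (1 / 2) * (‖a‖ ^ 2 + ‖b‖ ^ 2) = |t| := by
  obtain ⟨α, β, hαβ, hsq⟩ : ∃ α β : ℝ, α * β = t ∧ (1 / 2) * (α ^ 2 + β ^ 2) = |t| := by
    have hroot : √|t| ^ 2 = |t| := Real.sq_sqrt (abs_nonneg t)
    rcases abs_choice t with ht | ht
    · exact ⟨√|t|, √|t|, by linarith, by linarith⟩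
    · exact ⟨√|t|, -√|t|, by linarith, by linarith⟩
  refine ⟨EuclideanSpace.single 0 α, EuclideanSpace.single 1 β, ?_, ?_⟩
  · simpa [planeDet_eq] using hαβ
  · simpa using hsq

theorem abs_integral_planeDet_weakGrad_le (hu : MemH1 Ω u) (hv : MemH1 Ω v) :
    |∫ x in Ω, planeDet (weakGrad Ω u x) (weakGrad Ω v x)| ≤ dirichletEnergy Ω (u, v) := by
  rw [dirichletEnergy, ← integral_const_mul, ← Real.norm_eq_abs]
  have hu2 : IntegrableOn (fun x => ‖weakGrad Ω u x‖ ^ 2) Ω :=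
    hu.memLp_weakGrad.integrable_norm_pow two_ne_zero
  have hv2 : IntegrableOn (fun x => ‖weakGrad Ω v x‖ ^ 2) Ω :=
    hv.memLp_weakGrad.integrable_norm_pow two_ne_zero
  exact norm_integral_le_of_norm_le ((hu2.add hv2).const_mul (1 / 2))
    (Filter.Eventually.of_forall fun x => abs_planeDet_le _ _)

end Calibration

section LinearFunctions

variable {Ω : Set Plane}

theorem memH1_inner (hΩ : IsOpen Ω) (hmom : MemLp id 2 (volume.restrict Ω)) (a : Plane) :
    MemH1 Ω (inner ℝ a) := by
  have : IsFiniteMeasure (volume.restrict Ω) :=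
    isFiniteMeasure_of_memLp_id two_ne_zero ENNReal.ofNat_ne_top hmom
  have hgrad : gradient (inner ℝ a) = fun _ => a := funext (gradient_inner_left a)
  exact ⟨hmom.const_inner a, gradient (inner ℝ a), hgrad ▸ memLp_const a,
    isWeakGradient_gradient hΩ (contDiff_const.inner ℝ contDiff_id).contDiffOn⟩

theorem weakGrad_inner_ae_eq (hΩ : IsOpen Ω) (hmom : MemLp id 2 (volume.restrict Ω))
    (a : Plane) : weakGrad Ω (inner ℝ a) =ᵐ[volume.restrict Ω] fun _ => a :=
  ((memH1_inner hΩ hmom a).weakGrad_ae_eq_gradient hΩ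
    (contDiff_const.inner ℝ contDiff_id).contDiffOn).trans
    (Filter.Eventually.of_forall (gradient_inner_left a))

theorem integral_planeDet_weakGrad_inner (hΩ : IsOpen Ω)
    (hmom : MemLp id 2 (volume.restrict Ω)) (a b : Plane) :
    ∫ x in Ω, planeDet (weakGrad Ω (inner ℝ a) x) (weakGrad Ω (inner ℝ b) x) =
      volume.real Ω * planeDet a b := by
  rw [← smul_eq_mul, ← setIntegral_const]
  refine integral_congr_ae ?_
  filter_upwards [weakGrad_inner_ae_eq hΩ hmom a, weakGrad_inner_ae_eq hΩ hmom b] with x ha hb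
  rw [ha, hb]

theorem dirichletEnergy_inner (hΩ : IsOpen Ω) (hmom : MemLp id 2 (volume.restrict Ω))
    (a b : Plane) :
    dirichletEnergy Ω (inner ℝ a, inner ℝ b) =
      volume.real Ω * ((1 / 2) * (‖a‖ ^ 2 + ‖b‖ ^ 2)) := by
  rw [dirichletEnergy, mul_left_comm, ← smul_eq_mul (volume.real Ω), ← setIntegral_const]
  congr 1
  refine integral_congr_ae ?_
  filter_upwards [weakGrad_inner_ae_eq hΩ hmom a, weakGrad_inner_ae_eq hΩ hmom b] with x ha hb
  rw [ha, hb]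

end LinearFunctions

theorem mainTheorem8_general (Ω : Set Plane) (hopen : IsOpen Ω) (hne : Ω.Nonempty)
    (hmom : MemLp id 2 (volume.restrict Ω)) (c : ℝ) :
    ∃ p ∈ admissiblePairs Ω c, IsMinOn (dirichletEnergy Ω) (admissiblePairs Ω c) p := by
  have hfin : IsFiniteMeasure (volume.restrict Ω) :=
    isFiniteMeasure_of_memLp_id two_ne_zero ENNReal.ofNat_ne_top hmom
  have harea : 0 < volume.real Ω :=
    ENNReal.toReal_pos (hopen.measure_pos volume hne).ne' (isFiniteMeasure_restrict.1 hfin)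
  obtain ⟨a, b, hdet, henergy⟩ :=
    exists_planeDet_eq_and_half_norm_sq_add_eq_abs (c / volume.real Ω)
  refine ⟨(inner ℝ a, inner ℝ b),
    ⟨memH1_inner hopen hmom a, memH1_inner hopen hmom b, ?_⟩, isMinOn_iff.2 ?_⟩
  · rw [integral_planeDet_weakGrad_inner hopen hmom, hdet, mul_div_cancel₀ c harea.ne']
  · rintro ⟨u, v⟩ ⟨hu, hv, hc⟩
    calc dirichletEnergy Ω (inner ℝ a, inner ℝ b) = |c| := by
          rw [dirichletEnergy_inner hopen hmom, henergy, abs_div, abs_of_pos harea,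
            mul_div_cancel₀ _ harea.ne']
      _ = |∫ x in Ω, planeDet (weakGrad Ω u x) (weakGrad Ω v x)| := by rw [← hc]
      _ ≤ dirichletEnergy Ω (u, v) := abs_integral_planeDet_weakGrad_le hu hv

theorem mainTheorem8 (Ω : Set Plane) (hopen : IsOpen Ω) (hne : Ω.Nonempty)
    (hbdd : Bornology.IsBounded Ω) (c : ℝ) (hc : c ≠ 0) :
    ∃ p ∈ admissiblePairs Ω c, IsMinOn (dirichletEnergy Ω) (admissiblePairs Ω c) p :=
  mainTheorem8_general Ω hopen hne (memLp_id_restrict_of_isBounded hbdd) c
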